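/- Consider the linear-quadratic problem with dynamics $x_{k+1}=Ax_k+Bu_k$, $A\in\mathbb{R}^{n\times n}$, $B\in\mathbb{R}^{n\times m}$, and stage cost $\begin{pmatrix}x\\u\end{pmatrix}^\top H\begin{pmatrix}x\\u\end{pmatrix}$, $H=\begin{pmatrix}Q&S^\top\\S&R\end{pmatrix}$ symmetric. A solution of the associated DARE is a symmetric matrix $P\in\mathbb{R}^{n\times n}$ such that $R+B^\top PB$ is invertible and $$P=Q+A^\top PA-(S^\top+A^\top PB)K_P,\qquad K_P:=(R+B^\top PB)^{-1}(S+B^\top PA).$$ It is called stabilizing (respectively antistabilizing) if all complex eigenvalues $\mu$ of $A-BK_P$ satisfy $|\mu|<1$ (respectively $|\mu|>1$). Assume quadratic strict $(x,u)$-pre-dissipativity, i.e., there is a symmetric $\Lambda\in\mathbb{R}^{n\times n}$ with $$H_\Lambda=\begin{pmatrix}Q+\Lambda-A^\top\Lambda A & S^\top-A^\top\Lambda B\\ S-B^\top\Lambda A & R-B^\top\Lambda B\end{pmatrix}\succ0,$$ and assume that an antistabilizing solution $P_\mathrm{a}$ of the DARE exists. Then: (i) if $P$ is a solution of the DARE that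 is not stabilizing, then $P\nsucc P_\mathrm{a}$; (ii) if $P_\mathrm{s}$ is a stabilizing solution of the DARE, then $P_\mathrm{s}\succ P_\mathrm{a}$, and every solution $P\neq P_\mathrm{s}$ of the DARE satisfies $P\nsucc P_\mathrm{a}$; that is, $P_\mathrm{s}$ is the only solution of the DARE strictly above $P_\mathrm{a}$; (iii) if $(A,B)$ is stabilizable (i.e., all eigenvalues of $A-BF$ have modulus less than $1$ for some $F\in\mathbb{R}^{m\times n}$), then a stabilizing solution of the DARE exists and is unique. Here $X\succ Y$ means that $X-Y$ is symmetric positive definite. -/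

import Mathlib

open scoped Matrix

noncomputable section

/-- The data of a linear-quadratic problem with `n` states and `m` controls: dynamics
`x⁺ = A x + B u` and stage cost `ℓ(x,u) = (x,u)ᵀ H (x,u)` with `H = [Q Sᵀ; S R]` symmetric. -/
structure LQProblem (n m : ℕ) where
  A : Matrix (Fin n) (Fin n) ℝ
  B : Matrix (Fin n) (Fin m) ℝ
  Q : Matrix (Fin n) (Fin n) ℝ
  S : Matrix (Fin m) (Fin n) ℝ
  R : Matrix (Fin m) (Fin m) ℝ
  Q_symm : Q.IsSymm
  R_symm : R.IsSymm

/-- All complex eigenvalues `μ` of the real square matrix `M` satisfy `|μ| < 1`. -/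
def EigenvaluesInside {n : ℕ} (M : Matrix (Fin n) (Fin n) ℝ) : Prop :=
  ∀ μ ∈ spectrum ℂ (M.map (algebraMap ℝ ℂ)), ‖μ‖ < 1

/-- All complex eigenvalues `μ` of the real square matrix `M` satisfy `|μ| > 1`. -/
def EigenvaluesOutside {n : ℕ} (M : Matrix (Fin n) (Fin n) ℝ) : Prop :=
  ∀ μ ∈ spectrum ℂ (M.map (algebraMap ℝ ℂ)), 1 < ‖μ‖

namespace LQProblem

variable {n m : ℕ}

/-- The stage cost matrix `H_Λ` rotated with the storage function `λ(x) = xᵀ Λ x`. -/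
def rotatedCost (L : LQProblem n m) (Λ : Matrix (Fin n) (Fin n) ℝ) :
    Matrix (Fin n ⊕ Fin m) (Fin n ⊕ Fin m) ℝ :=
  Matrix.fromBlocks
    (L.Q + Λ - L.Aᵀ * Λ * L.A) (L.Sᵀ - L.Aᵀ * Λ * L.B)
    (L.S - L.Bᵀ * Λ * L.A)     (L.R - L.Bᵀ * Λ * L.B)

/-- Quadratic strict `(x,u)`-pre-dissipativity: `H_Λ ≻ 0` for some symmetric `Λ`. -/
def StrictlyPreDissipative (L : LQProblem n m) : Prop :=
  ∃ Λ : Matrix (Fin n) (Fin n) ℝ, Λ.IsSymm ∧ (L.rotatedCost Λ).PosDef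

/-- `(A,B)` is stabilizable. -/
def Stabilizable (L : LQProblem n m) : Prop :=
  ∃ F : Matrix (Fin m) (Fin n) ℝ, EigenvaluesInside (L.A - L.B * F)

/-- The feedback matrix `K = (R + Bᵀ P B)⁻¹ (S + Bᵀ P A)` associated with `P`. -/
def gain (L : LQProblem n m) (P : Matrix (Fin n) (Fin n) ℝ) : Matrix (Fin m) (Fin n) ℝ :=
  (L.R + L.Bᵀ * P * L.B)⁻¹ * (L.S + L.Bᵀ * P * L.A)

/-- `P` is a (symmetric) solution of the discrete algebraic Riccati equation. The inverse in the
feedback matrix is required to exist. -/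
structure IsDARESolution (L : LQProblem n m) (P : Matrix (Fin n) (Fin n) ℝ) : Prop where
  symm : P.IsSymm
  isUnit : IsUnit (L.R + L.Bᵀ * P * L.B)
  eq : P = L.Q + L.Aᵀ * P * L.A - (L.Sᵀ + L.Aᵀ * P * L.B) * L.gain P

/-- `P` is a stabilizing solution of the DARE. -/
def IsStabilizing (L : LQProblem n m) (P : Matrix (Fin n) (Fin n) ℝ) : Prop :=
  L.IsDARESolution P ∧ EigenvaluesInside (L.A - L.B * L.gain P)

/-- `P` is an antistabilizing solution of the DARE. -/
def IsAntistabilizing (L : LQProblem n m) (P : Matrix (Fin n) (Fin n) ℝ) : Prop :=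
  L.IsDARESolution P ∧ EigenvaluesOutside (L.A - L.B * L.gain P)

end LQProblem

end

/-! Write `A_P = A - B K_P`. Two solutions satisfy `A_{P₁}ᵀ (P₁ - P₂) A_{P₂} = P₁ - P₂`
(`IsDARESolution.stein`). If `P - P_a` is invertible, `A_P` is therefore similar to the stable
matrix `A_{P_a}⁻ᵀ`, so `P` is stabilizing; the same identity makes stabilizing solutions unique.
This gives (i) and the second half of (ii). Dissipativity yields the strict Lyapunov inequality `X -
A_Pᵀ X A_P ≻ 0` for `X = P + Λ`, whence `P_s + Λ ≻ 0 ≻ P_a + Λ`. For (iii), the Riccati equation for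
`D = P - P_a` becomes a linear Stein equation in `Y = D⁻¹`. Its solution is positive definite by
stabilizability and by `R + Bᵀ P_a B ≻ 0`, and `P_a + Y⁻¹` is the stabilizing solution. -/

open Filter Topology

/-! ### Spectral radius and decay of powers. -/

section Powers

/-- By Gelfand's formula, the powers of an element of spectral radius less than one tend to zero. -/
theorem tendsto_pow_zero_of_spectralRadius_lt_one {𝔸 : Type*} [NormedRing 𝔸] [NormedAlgebra ℂ 𝔸]
    [CompleteSpace 𝔸] {a : 𝔸} (h : spectralRadius ℂ a < 1) :
    Tendsto (fun k : ℕ => a ^ k) atTop (𝓝 0) := by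
  obtain ⟨r, hr, hr1⟩ := ENNReal.lt_iff_exists_nnreal_btwn.1 h
  have hr1' : (r : ℝ) < 1 := by exact_mod_cast hr1
  have ev := (spectrum.pow_nnnorm_pow_one_div_tendsto_nhds_spectralRadius a).eventually_lt_const hr
  refine squeeze_zero_norm' ?_ (tendsto_pow_atTop_nhds_zero_of_lt_one r.coe_nonneg hr1')
  filter_upwards [ev, eventually_gt_atTop 0] with k hk hk0
  have hk0' : (0 : ℝ) < k := by exact_mod_cast hk0
  have h1 := ENNReal.rpow_le_rpow hk.le hk0'.le
  rw [← ENNReal.rpow_mul, one_div, inv_mul_cancel₀ hk0'.ne', ENNReal.rpow_one,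
    ENNReal.rpow_natCast] at h1
  exact_mod_cast h1

theorem EigenvaluesInside.tendsto_pow {n : ℕ} {M : Matrix (Fin n) (Fin n) ℝ}
    (hM : EigenvaluesInside M) : Tendsto (fun k : ℕ => M ^ k) atTop (𝓝 0) := by
  -- Bounding the spectral radius eigenvalue by eigenvalue needs a nontrivial algebra, so `n = 0` is
  -- split off.
  cases isEmpty_or_nonempty (Fin n) with
  | inl h => simp [Subsingleton.elim M 0, Subsingleton.elim (_ ^ _) (0 : Matrix (Fin n) (Fin n) ℝ)]
  | inr h =>
    let _ := Matrix.linftyOpNormedRing (n := Fin n) (α := ℂ)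
    let _ := Matrix.linftyOpNormedAlgebra (n := Fin n) (R := ℂ) (α := ℂ)
    have hρ : spectralRadius ℂ (M.map (algebraMap ℝ ℂ)) < 1 := by
      refine spectrum.spectralRadius_lt_of_forall_lt _ fun μ hμ => ?_
      exact_mod_cast hM μ hμ
    have h1 := tendsto_pow_zero_of_spectralRadius_lt_one hρ
    refine tendsto_pi_nhds.2 fun i => tendsto_pi_nhds.2 fun j => ?_
    have h2 := tendsto_norm_zero.comp h1
    refine squeeze_zero_norm (fun k => ?_) h2
    have h3 : (M.map (algebraMap ℝ ℂ)) ^ k = (M ^ k).map (algebraMap ℝ ℂ) :=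
      (map_pow (algebraMap ℝ ℂ).mapMatrix M k).symm
    simp only [Function.comp, h3]
    rw [Matrix.linfty_opNorm_def]
    have h4 : ‖(M ^ k) i j‖ ≤ (∑ j, ‖((M ^ k).map (algebraMap ℝ ℂ)) i j‖₊ : NNReal) := by
      push_cast
      refine le_trans ?_ (Finset.single_le_sum (f := fun j => ‖((M ^ k).map (algebraMap ℝ ℂ)) i j‖)
        (fun _ _ => norm_nonneg _) (Finset.mem_univ j))
      simp
    refine h4.trans ?_
    exact_mod_cast Finset.le_sup (f := fun i => ∑ j, ‖((M ^ k).map (algebraMap ℝ ℂ)) i j‖₊)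
      (Finset.mem_univ i)

end Powers

/-! ### Eigenvalues under transposition, inversion and similarity. -/

section Spectrum

variable {n : ℕ} {M : Matrix (Fin n) (Fin n) ℝ}

theorem EigenvaluesOutside.isUnit (hM : EigenvaluesOutside M) : IsUnit M := by
  have h0 : (0 : ℂ) ∉ spectrum ℂ (M.map (algebraMap ℝ ℂ)) := fun h => by
    have := hM 0 h
    simp at this
    linarith
  rw [spectrum.zero_notMem_iff] at h0
  rw [Matrix.isUnit_iff_isUnit_det] at h0 ⊢
  have : (M.map (algebraMap ℝ ℂ)).det = algebraMap ℝ ℂ M.det :=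
    ((algebraMap ℝ ℂ).map_det M).symm
  rw [this] at h0
  simpa using h0

theorem EigenvaluesOutside.isUnit_one_sub (hM : EigenvaluesOutside M) : IsUnit (1 - M) := by
  have h0 : (1 : ℂ) ∉ spectrum ℂ (M.map (algebraMap ℝ ℂ)) := fun h => by
    have := hM 1 h
    simp at this
  rw [spectrum.notMem_iff, map_one] at h0
  rw [Matrix.isUnit_iff_isUnit_det] at h0 ⊢
  have : (1 - M.map (algebraMap ℝ ℂ)).det = algebraMap ℝ ℂ (1 - M).det := by
    rw [(algebraMap ℝ ℂ).map_det, map_sub, map_one]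
    rfl
  rw [this] at h0
  simpa using h0

theorem EigenvaluesInside.transpose (hM : EigenvaluesInside M) : EigenvaluesInside Mᵀ := by
  intro μ hμ
  apply hM μ
  rw [spectrum.mem_iff, Matrix.isUnit_iff_isUnit_det] at hμ ⊢
  rwa [← Matrix.det_transpose, Matrix.transpose_sub, Matrix.transpose_map,
    Matrix.transpose_transpose, Matrix.algebraMap_eq_diagonal, Matrix.diagonal_transpose,
    ← Matrix.algebraMap_eq_diagonal] at hμ

theorem EigenvaluesOutside.inv (hM : EigenvaluesOutside M) : EigenvaluesInside M⁻¹ := by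
  have hu : IsUnit M.det := (Matrix.isUnit_iff_isUnit_det _).1 hM.isUnit
  let f := (algebraMap ℝ ℂ).mapMatrix (m := Fin n)
  let a : (Matrix (Fin n) (Fin n) ℂ)ˣ :=
    ⟨f M, f M⁻¹, by rw [← map_mul, M.mul_nonsing_inv hu, map_one],
      by rw [← map_mul, M.nonsing_inv_mul hu, map_one]⟩
  intro μ hμ
  have h1 : μ ∈ spectrum ℂ (↑a⁻¹ : Matrix (Fin n) (Fin n) ℂ) := hμ
  have h2 : μ⁻¹ ∈ spectrum ℂ (a : Matrix (Fin n) (Fin n) ℂ) := spectrum.inv₀_mem_iff.2 h1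
  have h3 := hM _ h2
  rw [norm_inv] at h3
  rcases (norm_nonneg μ).eq_or_lt with h | h
  · rw [← h]; exact one_pos
  · exact (one_lt_inv₀ h).1 h3

/-- Similar matrices have the same eigenvalues. -/
theorem EigenvaluesInside.of_similar {N D : Matrix (Fin n) (Fin n) ℝ} (hD : IsUnit D)
    (h : D * N = M * D) (hM : EigenvaluesInside M) : EigenvaluesInside N := by
  intro μ hμ
  apply hM μ
  let f := (algebraMap ℝ ℂ).mapMatrix (m := Fin n)
  obtain ⟨d, hd⟩ := hD.map f
  have h1 : f N = (↑d⁻¹ : Matrix (Fin n) (Fin n) ℂ) * f M * d := by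
    rw [mul_assoc, Units.eq_inv_mul_iff_mul_eq, hd, ← map_mul, h, map_mul]
  change μ ∈ spectrum ℂ (f N) at hμ
  change μ ∈ spectrum ℂ (f M)
  rwa [h1, spectrum.units_conjugate'] at hμ

end Spectrum

/-! ### Stein equations and Lyapunov inequalities. -/

section Stein

variable {n : ℕ} {M : Matrix (Fin n) (Fin n) ℝ}

theorem tendsto_pow_mul_mul_pow {M N : Matrix (Fin n) (Fin n) ℝ}
    (hM : Tendsto (fun k : ℕ => M ^ k) atTop (𝓝 0)) (hN : Tendsto (fun k : ℕ => N ^ k) atTop (𝓝 0))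
    (X : Matrix (Fin n) (Fin n) ℝ) : Tendsto (fun k : ℕ => M ^ k * X * N ^ k) atTop (𝓝 0) := by
  simpa using (hM.mul_const X).mul hN

/-- A Stein equation with two stable coefficients has only the trivial homogeneous solution. -/
theorem eq_zero_of_stein {M N X : Matrix (Fin n) (Fin n) ℝ}
    (hM : Tendsto (fun k : ℕ => M ^ k) atTop (𝓝 0)) (hN : Tendsto (fun k : ℕ => N ^ k) atTop (𝓝 0))
    (h : M * X * N = X) : X = 0 := by
  have hk : ∀ k : ℕ, M ^ k * X * N ^ k = X := by
    intro k
    induction k with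
    | zero => simp
    | succ k ih =>
      calc M ^ (k + 1) * X * N ^ (k + 1) = M ^ k * (M * X * N) * N ^ k := by
            rw [pow_succ, pow_succ']; simp only [mul_assoc]
        _ = X := by rw [h, ih]
  have h1 := tendsto_pow_mul_mul_pow hM hN X
  simp only [hk] at h1
  exact tendsto_nhds_unique tendsto_const_nhds h1

/-- A Stein equation with two stable coefficients is solvable for every right-hand side. -/
theorem exists_stein_solution {M N : Matrix (Fin n) (Fin n) ℝ}
    (hM : Tendsto (fun k : ℕ => M ^ k) atTop (𝓝 0)) (hN : Tendsto (fun k : ℕ => N ^ k) atTop (𝓝 0))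
    (W : Matrix (Fin n) (Fin n) ℝ) : ∃ Y, Y = M * Y * N + W := by
  let T : Matrix (Fin n) (Fin n) ℝ →ₗ[ℝ] Matrix (Fin n) (Fin n) ℝ :=
    LinearMap.id - (LinearMap.mulRight ℝ N) ∘ₗ (LinearMap.mulLeft ℝ M)
  have hT : ∀ Y, T Y = Y - M * Y * N := fun Y => rfl
  have hinj : Function.Injective T := by
    rw [← LinearMap.ker_eq_bot, LinearMap.ker_eq_bot']
    intro Y hY
    rw [hT, sub_eq_zero] at hY
    exact eq_zero_of_stein hM hN hY.symm
  -- In finite dimension, uniqueness for the linear equation gives existence.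
  obtain ⟨Y, hY⟩ := LinearMap.surjective_of_injective hinj W
  exact ⟨Y, by rw [← hY, hT]; abel⟩

theorem tendsto_quadraticForm_zero (hM : Tendsto (fun k : ℕ => M ^ k) atTop (𝓝 0))
    (X : Matrix (Fin n) (Fin n) ℝ) (x : Fin n → ℝ) :
    Tendsto (fun k : ℕ => (M ^ k *ᵥ x) ⬝ᵥ (X *ᵥ (M ^ k *ᵥ x))) atTop (𝓝 0) := by
  have h : Continuous fun N : Matrix (Fin n) (Fin n) ℝ => (N *ᵥ x) ⬝ᵥ (X *ᵥ (N *ᵥ x)) := by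
    fun_prop
  have h1 := (h.tendsto 0).comp hM
  rwa [Matrix.zero_mulVec, zero_dotProduct] at h1

theorem quadraticForm_stein (X : Matrix (Fin n) (Fin n) ℝ) (x : Fin n → ℝ) :
    x ⬝ᵥ ((X - Mᵀ * X * M) *ᵥ x) = x ⬝ᵥ (X *ᵥ x) - (M *ᵥ x) ⬝ᵥ (X *ᵥ (M *ᵥ x)) := by
  rw [Matrix.sub_mulVec, dotProduct_sub, ← Matrix.mulVec_mulVec, ← Matrix.mulVec_mulVec,
    Matrix.dotProduct_mulVec x Mᵀ, Matrix.vecMul_transpose]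

/-- Along the orbit `M ^ k x` the quadratic form of `X` is nonincreasing and tends to zero, so it
starts nonnegative. -/
theorem quadraticForm_nonneg_of_stein (hM : Tendsto (fun k : ℕ => M ^ k) atTop (𝓝 0))
    {X : Matrix (Fin n) (Fin n) ℝ} (h : (X - Mᵀ * X * M).PosSemidef) (x : Fin n → ℝ) :
    0 ≤ x ⬝ᵥ (X *ᵥ x) := by
  have hanti : Antitone fun k : ℕ => (M ^ k *ᵥ x) ⬝ᵥ (X *ᵥ (M ^ k *ᵥ x)) := by
    refine antitone_nat_of_succ_le fun k => ?_
    have h1 := h.dotProduct_mulVec_nonneg (M ^ k *ᵥ x)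
    have h2 : M *ᵥ (M ^ k *ᵥ x) = M ^ (k + 1) *ᵥ x := by
      rw [Matrix.mulVec_mulVec, ← pow_succ']
    rw [star_trivial, quadraticForm_stein, h2] at h1
    linarith
  simpa using hanti.le_of_tendsto (tendsto_quadraticForm_zero hM X x) 0

/-- Lyapunov's theorem in discrete time. -/
theorem posDef_of_stein (hM : Tendsto (fun k : ℕ => M ^ k) atTop (𝓝 0))
    {X : Matrix (Fin n) (Fin n) ℝ} (hX : X.IsSymm) (h : (X - Mᵀ * X * M).PosDef) : X.PosDef := by
  refine Matrix.PosDef.of_dotProduct_mulVec_pos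
    (by rwa [Matrix.IsHermitian, Matrix.conjTranspose_eq_transpose_of_trivial]) fun x hx => ?_
  have h1 := h.dotProduct_mulVec_pos hx
  rw [star_trivial, quadraticForm_stein] at h1
  rw [star_trivial]
  have h2 := quadraticForm_nonneg_of_stein hM h.posSemidef (M *ᵥ x)
  linarith

end Stein

/-! ### Comparing solutions; consequences of dissipativity. -/

namespace LQProblem

variable {n m : ℕ} {L : LQProblem n m} {P P₁ P₂ Λ : Matrix (Fin n) (Fin n) ℝ}

theorem IsDARESolution.weight_mul_gain (h : L.IsDARESolution P) :
    (L.R + L.Bᵀ * P * L.B) * L.gain P = L.S + L.Bᵀ * P * L.A := by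
  rw [gain, Matrix.mul_nonsing_inv_cancel_left _ _ ((Matrix.isUnit_iff_isUnit_det _).1 h.isUnit)]

theorem weight_isSymm (L : LQProblem n m) (hP : P.IsSymm) : (L.R + L.Bᵀ * P * L.B).IsSymm := by
  simp [Matrix.IsSymm, Matrix.transpose_add, Matrix.transpose_mul, hP.eq, L.R_symm.eq,
    Matrix.mul_assoc]

theorem IsDARESolution.gain_transpose_mul_weight (h : L.IsDARESolution P) :
    (L.gain P)ᵀ * (L.R + L.Bᵀ * P * L.B) = L.Sᵀ + L.Aᵀ * P * L.B := by
  have h1 := congrArg Matrix.transpose h.weight_mul_gain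
  rw [Matrix.transpose_mul, (L.weight_isSymm h.symm).eq] at h1
  rw [h1]
  simp [Matrix.transpose_add, Matrix.transpose_mul, h.symm.eq, Matrix.mul_assoc]

/-- The gain equation removes every `P` except the leading one. The feedback `F` is free so that the
gain of another solution can be inserted. -/
theorem IsDARESolution.closedLoop_left (h : L.IsDARESolution P) (F : Matrix (Fin m) (Fin n) ℝ) :
    (L.A - L.B * L.gain P)ᵀ * P * (L.A - L.B * F) =
      P - L.Q + (L.gain P)ᵀ * L.S + L.Sᵀ * F - (L.gain P)ᵀ * L.R * F := by
  have h1 := h.eq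
  have h2 := congrArg ((L.gain P)ᵀ * ·) h.weight_mul_gain
  have h3 := congrArg (· * F) h.gain_transpose_mul_weight
  have h4 := congrArg (· * L.gain P) h.gain_transpose_mul_weight
  set K := L.gain P
  simp only [Matrix.transpose_sub, Matrix.transpose_mul, Matrix.mul_add, Matrix.add_mul,
    Matrix.mul_sub, Matrix.sub_mul, Matrix.mul_assoc] at h1 h2 h3 h4 ⊢
  -- Matrix products do not commute, so the expanded monomials are cancelled additively.
  linear_combination (norm := skip) h2 + h3 - h1 - h4
  abel

theorem IsDARESolution.closedLoop_right (h : L.IsDARESolution P) (F : Matrix (Fin m) (Fin n) ℝ) :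
    (L.A - L.B * F)ᵀ * P * (L.A - L.B * L.gain P) =
      P - L.Q + Fᵀ * L.S + L.Sᵀ * L.gain P - Fᵀ * L.R * L.gain P := by
  have h1 := congrArg Matrix.transpose (h.closedLoop_left F)
  simp only [Matrix.transpose_sub, Matrix.transpose_add, Matrix.transpose_mul, h.symm.eq,
    L.Q_symm.eq, L.R_symm.eq, Matrix.transpose_transpose, Matrix.mul_assoc] at h1 ⊢
  rw [h1]
  abel

/-- The difference of two solutions satisfies a homogeneous Stein equation whose coefficients are
the two closed-loop matrices. -/
theorem IsDARESolution.stein (h₁ : L.IsDARESolution P₁) (h₂ : L.IsDARESolution P₂) :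
    (L.A - L.B * L.gain P₁)ᵀ * (P₁ - P₂) * (L.A - L.B * L.gain P₂) = P₁ - P₂ := by
  rw [Matrix.mul_sub _ P₁ P₂, Matrix.sub_mul, h₁.closedLoop_left, h₂.closedLoop_right]
  abel

theorem IsStabilizing.unique (h₁ : L.IsStabilizing P₁) (h₂ : L.IsStabilizing P₂) : P₁ = P₂ :=
  sub_eq_zero.1 (eq_zero_of_stein h₁.2.transpose.tendsto_pow h₂.2.tendsto_pow (h₁.1.stein h₂.1))

/-- A solution whose difference to the antistabilizing one is invertible is stabilizing. -/
theorem IsDARESolution.isStabilizing_of_isUnit_sub (h₁ : L.IsDARESolution P₁)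
    (h₂ : L.IsAntistabilizing P₂) (hD : IsUnit (P₁ - P₂)) : L.IsStabilizing P₁ := by
  refine ⟨h₁, ?_⟩
  have hu : IsUnit (L.A - L.B * L.gain P₂)ᵀ.det := by
    rw [Matrix.det_transpose]
    exact (Matrix.isUnit_iff_isUnit_det _).1 h₂.2.isUnit
  refine (h₂.2.inv.transpose).of_similar hD ?_
  have h := h₂.1.stein h₁
  have h' : (L.A - L.B * L.gain P₂)ᵀ * ((P₁ - P₂) * (L.A - L.B * L.gain P₁)) = P₁ - P₂ := by
    rw [← neg_sub P₂ P₁, Matrix.neg_mul, Matrix.mul_neg, ← Matrix.mul_assoc, h]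
  calc (P₁ - P₂) * (L.A - L.B * L.gain P₁)
      = ((L.A - L.B * L.gain P₂)ᵀ)⁻¹ *
          ((L.A - L.B * L.gain P₂)ᵀ * ((P₁ - P₂) * (L.A - L.B * L.gain P₁))) := by
        rw [Matrix.nonsing_inv_mul_cancel_left _ _ hu]
    _ = _ := by rw [h', Matrix.transpose_nonsing_inv]

/-- Completion of squares in the dissipation inequality. -/
theorem IsDARESolution.completion_of_squares {k : ℕ} (h : L.IsDARESolution P)
    (T : Matrix (Fin n) (Fin k) ℝ) (U : Matrix (Fin m) (Fin k) ℝ) :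
    (Matrix.fromRows T U)ᵀ * L.rotatedCost Λ * Matrix.fromRows T U =
      (U + L.gain P * T)ᵀ * (L.R + L.Bᵀ * P * L.B) * (U + L.gain P * T) + Tᵀ * (P + Λ) * T
        - (L.A * T + L.B * U)ᵀ * (P + Λ) * (L.A * T + L.B * U) := by
  have h1 := congrArg (Tᵀ * · * T) h.eq
  have h2 := congrArg (Uᵀ * · * T) h.weight_mul_gain
  have h3 := congrArg (Tᵀ * · * U) h.gain_transpose_mul_weight
  have h4 := congrArg (Tᵀ * · * L.gain P * T) h.gain_transpose_mul_weight
  rw [rotatedCost, Matrix.mul_assoc, Matrix.fromBlocks_mul_fromRows, Matrix.transpose_fromRows,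
    Matrix.fromCols_mul_fromRows]
  simp only [Matrix.transpose_add, Matrix.transpose_mul, Matrix.mul_add, Matrix.add_mul,
    Matrix.mul_sub, Matrix.sub_mul, Matrix.mul_assoc] at h1 h2 h3 h4 ⊢
  linear_combination (norm := skip) - h1 - h2 - h3 - h4
  abel

theorem posDef_fromRows_congr {k : ℕ} (hΛ : (L.rotatedCost Λ).PosDef)
    {T : Matrix (Fin n) (Fin k) ℝ} {U : Matrix (Fin m) (Fin k) ℝ}
    (hTU : ∀ x, T *ᵥ x = 0 → U *ᵥ x = 0 → x = 0) :
    ((Matrix.fromRows T U)ᵀ * L.rotatedCost Λ * Matrix.fromRows T U).PosDef := by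
  rw [← Matrix.conjTranspose_eq_transpose_of_trivial]
  refine hΛ.conjTranspose_mul_mul_same fun x y hxy => ?_
  rw [← sub_eq_zero] at hxy ⊢
  rw [← Matrix.mulVec_sub, Matrix.fromRows_mulVec] at hxy
  refine hTU _ (funext fun i => ?_) (funext fun i => ?_)
  · simpa using congrFun hxy (Sum.inl i)
  · simpa using congrFun hxy (Sum.inr i)

theorem IsDARESolution.posDef_stein (h : L.IsDARESolution P) (hΛ : (L.rotatedCost Λ).PosDef) :
    ((P + Λ) - (L.A - L.B * L.gain P)ᵀ * (P + Λ) * (L.A - L.B * L.gain P)).PosDef := by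
  -- Applying the feedback `u = -K x` makes the completed square vanish.
  have h1 := posDef_fromRows_congr hΛ (T := 1) (U := -L.gain P) fun x hx _ => by simpa using hx
  rw [h.completion_of_squares] at h1
  simpa [sub_eq_add_neg] using h1

theorem IsStabilizing.posDef_add (h : L.IsStabilizing P) (hΛs : Λ.IsSymm)
    (hΛ : (L.rotatedCost Λ).PosDef) : (P + Λ).PosDef :=
  posDef_of_stein h.2.tendsto_pow (h.1.symm.add hΛs) (h.1.posDef_stein hΛ)

/-- Congruence with `A_P⁻¹` reverses the Lyapunov inequality: `-(P + Λ)` satisfies it for the stable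
matrix `A_P⁻¹`. -/
theorem IsAntistabilizing.posDef_neg_add (h : L.IsAntistabilizing P) (hΛs : Λ.IsSymm)
    (hΛ : (L.rotatedCost Λ).PosDef) : (-(P + Λ)).PosDef := by
  have hu := (Matrix.isUnit_iff_isUnit_det _).1 h.2.isUnit
  refine posDef_of_stein h.2.inv.tendsto_pow (h.1.symm.add hΛs).neg ?_
  have h1 := (h.1.posDef_stein hΛ).conjTranspose_mul_mul_same
    (B := (L.A - L.B * L.gain P)⁻¹) (Matrix.mulVec_injective_iff_isUnit.2
      ((Matrix.isUnit_nonsing_inv_iff).2 h.2.isUnit))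
  rw [Matrix.conjTranspose_eq_transpose_of_trivial, Matrix.mul_sub, Matrix.sub_mul] at h1
  have h2 : ((L.A - L.B * L.gain P)⁻¹)ᵀ *
      ((L.A - L.B * L.gain P)ᵀ * (P + Λ) * (L.A - L.B * L.gain P)) *
        (L.A - L.B * L.gain P)⁻¹ = P + Λ := by
    rw [Matrix.mul_assoc, Matrix.mul_nonsing_inv_cancel_right _ _ hu, ← Matrix.mul_assoc,
      ← Matrix.transpose_mul, Matrix.mul_nonsing_inv _ hu, Matrix.transpose_one, Matrix.one_mul]
  rw [h2] at h1
  convert h1 using 1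
  rw [Matrix.mul_neg, Matrix.neg_mul]
  abel

/-- Evaluate the dissipation inequality at the equilibria of the closed loop. -/
theorem IsAntistabilizing.weight_posDef (h : L.IsAntistabilizing P)
    (hΛ : (L.rotatedCost Λ).PosDef) : (L.R + L.Bᵀ * P * L.B).PosDef := by
  have hu := (Matrix.isUnit_iff_isUnit_det _).1 h.2.isUnit_one_sub
  -- `T v` is the equilibrium under `u = -K x + v`. There the two `P + Λ` terms cancel and the
  -- completed square leaves exactly the weight.
  set T := (1 - (L.A - L.B * L.gain P))⁻¹ * L.B with hT
  have hT' : L.A * T + L.B * (1 - L.gain P * T) = T := by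
    have h1 : (1 - (L.A - L.B * L.gain P)) * T = L.B := by
      rw [hT, Matrix.mul_nonsing_inv_cancel_left _ _ hu]
    simp only [Matrix.sub_mul, Matrix.one_mul, Matrix.mul_sub, Matrix.mul_one,
      Matrix.mul_assoc] at h1 ⊢
    linear_combination (norm := skip) - h1
    abel
  have h1 := posDef_fromRows_congr hΛ (T := T) (U := 1 - L.gain P * T) fun x hx hx' => by
    rwa [Matrix.sub_mulVec, Matrix.one_mulVec, ← Matrix.mulVec_mulVec, hx, Matrix.mulVec_zero,
      sub_zero] at hx'
  rw [h.1.completion_of_squares, hT'] at h1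
  simpa using h1

end LQProblem

/-! ### Constructing the stabilizing solution. -/

namespace LQProblem

variable {n m : ℕ} {L : LQProblem n m} {P₀ : Matrix (Fin n) (Fin n) ℝ}

/-- For `M⁻¹` stable and `W` positive definite, a symmetric solution of `M Y Mᵀ = Y + B W Bᵀ` is
positive definite if `M - B G` is stable for some feedback `G`. -/
theorem posDef_of_stein_of_stabilizable {M Y : Matrix (Fin n) (Fin n) ℝ}
    {B : Matrix (Fin n) (Fin m) ℝ} {W : Matrix (Fin m) (Fin m) ℝ} {G : Matrix (Fin m) (Fin n) ℝ}
    (hM : IsUnit M.det) (hC : Tendsto (fun k : ℕ => (M⁻¹)ᵀ ^ k) atTop (𝓝 0)) (hW : W.PosDef)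
    (hG : Tendsto (fun k : ℕ => (M - B * G)ᵀ ^ k) atTop (𝓝 0)) (hY : Y.IsSymm)
    (h : Y = M⁻¹ * Y * (M⁻¹)ᵀ + M⁻¹ * (B * W * Bᵀ) * (M⁻¹)ᵀ) : Y.PosDef := by
  set C := M⁻¹ with hCdef
  have h1 : Y - (Cᵀ)ᵀ * Y * Cᵀ = (Bᵀ * Cᵀ)ᵀ * W * (Bᵀ * Cᵀ) := by
    rw [Matrix.transpose_transpose, Matrix.transpose_mul, Matrix.transpose_transpose,
      Matrix.transpose_transpose, sub_eq_iff_eq_add']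
    simpa only [Matrix.mul_assoc] using h
  have h2 : (Y - (Cᵀ)ᵀ * Y * Cᵀ).PosSemidef := by
    rw [h1, ← Matrix.conjTranspose_eq_transpose_of_trivial (Bᵀ * Cᵀ)]
    exact hW.posSemidef.conjTranspose_mul_mul_same _
  have hnonneg := quadraticForm_nonneg_of_stein hC h2
  have hstep : ∀ x, x ⬝ᵥ (Y *ᵥ x) = 0 →
      (Cᵀ *ᵥ x) ⬝ᵥ (Y *ᵥ (Cᵀ *ᵥ x)) = 0 ∧ Bᵀ *ᵥ (Cᵀ *ᵥ x) = 0 := by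
    intro x hx
    have h3 := quadraticForm_stein (M := Cᵀ) Y x
    have h4 : x ⬝ᵥ ((Y - (Cᵀ)ᵀ * Y * Cᵀ) *ᵥ x) =
        (Bᵀ *ᵥ (Cᵀ *ᵥ x)) ⬝ᵥ (W *ᵥ (Bᵀ *ᵥ (Cᵀ *ᵥ x))) := by
      rw [h1, ← Matrix.mulVec_mulVec, ← Matrix.mulVec_mulVec, Matrix.dotProduct_mulVec x,
        Matrix.vecMul_transpose, ← Matrix.mulVec_mulVec]
    have h5 := hnonneg (Cᵀ *ᵥ x)
    by_cases h6 : Bᵀ *ᵥ (Cᵀ *ᵥ x) = 0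
    · refine ⟨?_, h6⟩
      rw [h6, zero_dotProduct] at h4
      linarith
    · have h7 := hW.dotProduct_mulVec_pos h6
      rw [star_trivial] at h7
      linarith
  refine Matrix.PosDef.of_dotProduct_mulVec_pos
    (by rwa [Matrix.IsHermitian, Matrix.conjTranspose_eq_transpose_of_trivial]) fun x hx => ?_
  rw [star_trivial]
  refine (hnonneg x).lt_of_ne fun hx0 => hx ?_
  -- On a null vector `Bᵀ` kills the `Cᵀ`-orbit, so `(M - B G)ᵀ` acts on it as `Mᵀ` and undoes each
  -- step. Both factors decay, forcing `x = 0`.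
  have hk : ∀ k : ℕ, (Cᵀ ^ k *ᵥ x) ⬝ᵥ (Y *ᵥ (Cᵀ ^ k *ᵥ x)) = 0 ∧
      (M - B * G)ᵀ ^ k *ᵥ (Cᵀ ^ k *ᵥ x) = x := by
    intro k
    induction k with
    | zero => simpa using hx0.symm
    | succ k ih =>
      have h3 := hstep _ ih.1
      have h4 : Cᵀ ^ (k + 1) *ᵥ x = Cᵀ *ᵥ (Cᵀ ^ k *ᵥ x) := by
        rw [Matrix.mulVec_mulVec, ← pow_succ']
      have h5 : (M - B * G)ᵀ *ᵥ (Cᵀ *ᵥ (Cᵀ ^ k *ᵥ x)) = Cᵀ ^ k *ᵥ x := by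
        rw [Matrix.transpose_sub, Matrix.sub_mulVec, Matrix.transpose_mul, ← Matrix.mulVec_mulVec,
          h3.2, Matrix.mulVec_zero, sub_zero, Matrix.mulVec_mulVec, ← Matrix.transpose_mul,
          hCdef, Matrix.nonsing_inv_mul _ hM, Matrix.transpose_one, Matrix.one_mulVec]
      refine ⟨by rw [h4]; exact h3.1, ?_⟩
      rw [pow_succ (M - B * G)ᵀ, ← Matrix.mulVec_mulVec, h4, h5, ih.2]
  have hlim := tendsto_pow_mul_mul_pow hG hC 1
  have hcont : Continuous fun N : Matrix (Fin n) (Fin n) ℝ => N *ᵥ x := by fun_prop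
  have hlim' := (hcont.tendsto 0).comp hlim
  rw [Matrix.zero_mulVec] at hlim'
  refine tendsto_nhds_unique tendsto_const_nhds (hlim'.congr fun k => ?_)
  rw [Function.comp, mul_one, ← Matrix.mulVec_mulVec, (hk k).2]

/-- Shifting a solution by the inverse of a solution of a linear Stein equation yields another
solution. -/
theorem IsDARESolution.add_of_stein (h : L.IsDARESolution P₀) {Y D : Matrix (Fin n) (Fin n) ℝ}
    (hD : D.IsSymm) (hYD : Y * D = 1)
    (hY : (L.A - L.B * L.gain P₀) * Y * (L.A - L.B * L.gain P₀)ᵀ =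
      Y + L.B * (L.R + L.Bᵀ * P₀ * L.B)⁻¹ * L.Bᵀ)
    (hu : IsUnit (L.R + L.Bᵀ * (P₀ + D) * L.B)) : L.IsDARESolution (P₀ + D) := by
  refine ⟨h.symm.add hD, hu, ?_⟩
  have hu₀ := (Matrix.isUnit_iff_isUnit_det _).1 h.isUnit
  have hu' := (Matrix.isUnit_iff_isUnit_det _).1 hu
  have hgain := Matrix.mul_nonsing_inv_cancel_left _ (L.S + L.Bᵀ * (P₀ + D) * L.A) hu'
  rw [← gain] at hgain
  have hgain₀ := h.weight_mul_gain
  have hgainT := h.gain_transpose_mul_weight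
  have heq := h.eq
  have hwt : L.R + L.Bᵀ * (P₀ + D) * L.B = (L.R + L.Bᵀ * P₀ * L.B) + L.Bᵀ * D * L.B := by
    rw [Matrix.mul_add, Matrix.add_mul, add_assoc]
  set K := L.gain (P₀ + D)
  set K₀ := L.gain P₀
  set V := L.R + L.Bᵀ * (P₀ + D) * L.B
  set V₀ := L.R + L.Bᵀ * P₀ * L.B
  set M := L.A - L.B * K₀ with hM
  have h5 : V * (V⁻¹ * L.Bᵀ * D * M) = L.Bᵀ * D * M := by
    rw [Matrix.mul_assoc, Matrix.mul_assoc, Matrix.mul_nonsing_inv_cancel_left _ _ hu',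
      Matrix.mul_assoc]
  -- the gain update
  have hE : K = K₀ + V⁻¹ * L.Bᵀ * D * M := by
    have h1 : V * K = V * (K₀ + V⁻¹ * L.Bᵀ * D * M) := by
      rw [hgain, Matrix.mul_add V K₀, h5, hwt, Matrix.add_mul V₀, hgain₀, hM]
      simp only [Matrix.mul_sub, Matrix.mul_add, Matrix.add_mul, Matrix.mul_assoc]
      abel
    rw [← Matrix.nonsing_inv_mul_cancel_left _ K hu', h1,
      Matrix.nonsing_inv_mul_cancel_left _ _ hu']
  -- the Riccati equation in the difference
  have hinv : (1 - L.B * V⁻¹ * L.Bᵀ * D) * (1 + L.B * V₀⁻¹ * L.Bᵀ * D) = 1 := by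
    have h1 : V⁻¹ * V * V₀⁻¹ = V⁻¹ * V₀ * V₀⁻¹ + V⁻¹ * (L.Bᵀ * D * L.B) * V₀⁻¹ := by
      rw [← Matrix.add_mul, ← Matrix.mul_add, ← hwt]
    rw [Matrix.nonsing_inv_mul _ hu', Matrix.one_mul, Matrix.mul_assoc V⁻¹,
      Matrix.mul_nonsing_inv _ hu₀, Matrix.mul_one] at h1
    have h2 := congrArg (fun Z => L.B * Z * (L.Bᵀ * D)) h1
    simp only [Matrix.sub_mul, Matrix.mul_add, Matrix.add_mul, Matrix.one_mul,
      Matrix.mul_one, Matrix.mul_assoc] at h2 ⊢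
    linear_combination (norm := skip) h2
    abel
  have hX : D * (1 - L.B * V⁻¹ * L.Bᵀ * D) * (M * Y * Mᵀ) = 1 := by
    have h1 : M * Y * Mᵀ = (1 + L.B * V₀⁻¹ * L.Bᵀ * D) * Y := by
      rw [hY, Matrix.add_mul, Matrix.one_mul, Matrix.mul_assoc _ D Y, mul_eq_one_comm.1 hYD,
        Matrix.mul_one]
    rw [h1, Matrix.mul_assoc D, ← Matrix.mul_assoc _ _ Y, hinv, Matrix.one_mul,
      mul_eq_one_comm.1 hYD]
  have hDM : Mᵀ * (D * (1 - L.B * V⁻¹ * L.Bᵀ * D)) * M = D := by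
    have h1 : Mᵀ * (D * (1 - L.B * V⁻¹ * L.Bᵀ * D) * M * Y) = 1 := by
      rw [mul_eq_one_comm]
      simpa only [Matrix.mul_assoc] using hX
    calc _ = Mᵀ * (D * (1 - L.B * V⁻¹ * L.Bᵀ * D) * M * Y) * D := by
          simp only [Matrix.mul_assoc, hYD, Matrix.mul_one]
      _ = D := by rw [h1, Matrix.one_mul]
  have hstep : L.Sᵀ + L.Aᵀ * (P₀ + D) * L.B = K₀ᵀ * V + Mᵀ * D * L.B := by
    rw [hwt, Matrix.mul_add K₀ᵀ V₀, hgainT, hM, Matrix.transpose_sub, Matrix.transpose_mul]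
    simp only [Matrix.sub_mul, Matrix.mul_add, Matrix.add_mul, Matrix.mul_assoc]
    abel
  have h3 := congrArg (K₀ᵀ * · * K₀) hwt
  have h4 := congrArg (· * K₀) hgainT
  have hA : L.A = M + L.B * K₀ := by rw [hM, sub_add_cancel]
  have h6 := congrArg (K₀ᵀ * ·) h5
  rw [hstep, hE]
  have h7 : L.Aᵀ * D * L.A =
      Mᵀ * D * M + Mᵀ * D * L.B * K₀ + K₀ᵀ * L.Bᵀ * D * M + K₀ᵀ * L.Bᵀ * D * L.B * K₀ := by
    rw [hA, Matrix.transpose_add, Matrix.transpose_mul]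
    simp only [Matrix.mul_add, Matrix.add_mul, Matrix.mul_assoc]
    abel
  clear_value K K₀ V V₀ M
  simp only [Matrix.mul_sub, Matrix.sub_mul, Matrix.mul_add, Matrix.add_mul, Matrix.mul_assoc,
    Matrix.mul_one] at h3 h4 h6 h7 heq hDM ⊢
  linear_combination (norm := skip) heq - hDM - h7 + h3 + h6 + h4
  abel

theorem IsAntistabilizing.exists_isStabilizing (h : L.IsAntistabilizing P₀)
    (hdiss : L.StrictlyPreDissipative) (hstab : L.Stabilizable) : ∃ P, L.IsStabilizing P := by
  obtain ⟨Λ, -, hΛ⟩ := hdiss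
  obtain ⟨F, hF⟩ := hstab
  have hV := h.weight_posDef hΛ
  have hu := (Matrix.isUnit_iff_isUnit_det _).1 h.2.isUnit
  set M := L.A - L.B * L.gain P₀ with hM
  have hC := h.2.inv.tendsto_pow
  have hCT := h.2.inv.transpose.tendsto_pow
  set W := L.B * (L.R + L.Bᵀ * P₀ * L.B)⁻¹ * L.Bᵀ with hW
  have hWs : W.IsSymm := by
    have h1 : ((L.R + L.Bᵀ * P₀ * L.B)⁻¹)ᵀ = (L.R + L.Bᵀ * P₀ * L.B)⁻¹ := by
      rw [Matrix.transpose_nonsing_inv, (L.weight_isSymm h.1.symm).eq]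
    rw [hW, Matrix.IsSymm, Matrix.transpose_mul, Matrix.transpose_mul, h1,
      Matrix.transpose_transpose, Matrix.mul_assoc L.B]
  obtain ⟨Y, hY⟩ := exists_stein_solution hC hCT (M⁻¹ * W * (M⁻¹)ᵀ)
  have hYs : Y.IsSymm := by
    have h1 := congrArg Matrix.transpose hY
    simp only [Matrix.transpose_add, Matrix.transpose_mul, Matrix.transpose_transpose, hWs.eq,
      ← Matrix.mul_assoc] at h1
    -- `Yᵀ` solves the same equation, so uniqueness gives symmetry.
    refine sub_eq_zero.1 (eq_zero_of_stein hC hCT ?_)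
    rw [Matrix.mul_sub, Matrix.sub_mul]
    linear_combination (norm := skip) hY - h1
    abel
  have hFM : L.A - L.B * F = M - L.B * (F - L.gain P₀) := by
    rw [hM, Matrix.mul_sub]
    abel
  rw [hFM] at hF
  have hYpos : Y.PosDef :=
    posDef_of_stein_of_stabilizable hu hCT hV.inv hF.transpose.tendsto_pow hYs hY
  have hYM : M * Y * Mᵀ = Y + W := by
    have hu' : IsUnit Mᵀ.det := by rwa [Matrix.det_transpose]
    have h1 : Y = M⁻¹ * ((Y + W) * (Mᵀ)⁻¹) := by
      rw [← Matrix.transpose_nonsing_inv, ← Matrix.mul_assoc, Matrix.mul_add, Matrix.add_mul]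
      exact hY
    conv_lhs => rw [h1]
    rw [Matrix.mul_nonsing_inv_cancel_left _ _ hu, Matrix.nonsing_inv_mul_cancel_right _ _ hu']
  have hYu := (Matrix.isUnit_iff_isUnit_det _).1 hYpos.isUnit
  have hVpos : (L.R + L.Bᵀ * (P₀ + Y⁻¹) * L.B).PosDef := by
    have h1 := hYpos.inv.posSemidef.conjTranspose_mul_mul_same L.B
    rw [Matrix.conjTranspose_eq_transpose_of_trivial] at h1
    have h2 := hV.add_posSemidef h1
    rwa [add_assoc, ← Matrix.add_mul, ← Matrix.mul_add] at h2
  have hDs : (Y⁻¹).IsSymm := by rw [Matrix.IsSymm, Matrix.transpose_nonsing_inv, hYs.eq]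
  -- Stability needs no separate estimate: the difference `Y⁻¹` to the antistabilizing solution is
  -- invertible.
  refine ⟨P₀ + Y⁻¹, (h.1.add_of_stein hDs (Matrix.mul_nonsing_inv _ hYu) hYM
    hVpos.isUnit).isStabilizing_of_isUnit_sub h ?_⟩
  rw [add_sub_cancel_left]
  exact hYpos.inv.isUnit

end LQProblem

theorem mainTheorem9 {n m : ℕ} (L : LQProblem n m) (hdiss : L.StrictlyPreDissipative)
    (Pa : Matrix (Fin n) (Fin n) ℝ) (hPa : L.IsAntistabilizing Pa) :
    -- no solution that is not stabilizing is strictly above `Pa`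
    (∀ P : Matrix (Fin n) (Fin n) ℝ,
      L.IsDARESolution P → ¬ L.IsStabilizing P → ¬ (P - Pa).PosDef) ∧
    -- the stabilizing solution is strictly above `Pa`, and no other solution is
    (∀ Ps : Matrix (Fin n) (Fin n) ℝ, L.IsStabilizing Ps →
      (Ps - Pa).PosDef ∧
      ∀ P : Matrix (Fin n) (Fin n) ℝ, L.IsDARESolution P → P ≠ Ps → ¬ (P - Pa).PosDef) ∧
    -- the stabilizing solution exists and is unique when `(A,B)` is stabilizable
    (L.Stabilizable → ∃! Ps : Matrix (Fin n) (Fin n) ℝ, L.IsStabilizing Ps) := by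
  refine ⟨fun P hP hns hpos => hns (hP.isStabilizing_of_isUnit_sub hPa hpos.isUnit),
    fun Ps hPs => ⟨?_, fun P hP hne hpos =>
      hne ((hP.isStabilizing_of_isUnit_sub hPa hpos.isUnit).unique hPs)⟩, fun hstab => ?_⟩
  · obtain ⟨Λ, hΛs, hΛ⟩ := hdiss
    have h1 := (hPs.posDef_add hΛs hΛ).add (hPa.posDef_neg_add hΛs hΛ)
    rwa [← sub_eq_add_neg, add_sub_add_right_eq_sub] at h1
  · obtain ⟨Ps, hPs⟩ := hPa.exists_isStabilizing hdiss hstab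
    exact ⟨Ps, hPs, fun P hP => hP.unique hPs⟩
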